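/- Let $p$ be a prime and let $\lambda$ be a symmetric partition (i.e. equal to its dual), with $p$-core $\lambda^0$ and $p$-quotient $(\lambda_0,\dots,\lambda_{p-1})$. Here the $p$-quotient is computed from a $\beta$-set $X$ of $\lambda$ with $|X|\equiv 0 \pmod p$: $\lambda_\gamma$ is the partition with $\beta$-set $X_\gamma=\{j:\gamma+jp\in X\}$. For a partition $\mu$ let $D(\mu)_L$ and $D(\mu)_R$ be the sets of leg lengths and of arm lengths, respectively, of the diagonal hooks of $\mu$, let $D(\mu)$ be the set of pairs $(\alpha|\beta)$ of the leg length and the arm length of the same diagonal hook, and let $\delta(\mu)$ be the set of diagonal hook lengths of $\mu$. For $0\le\gamma\le p-1$ put $$D_\gamma(\mu)_L=\{m\ge 0: (p-1-\gamma)+mp\in D(\mu)_L\},\qquad D_\gamma(\mu)_R=\{m\ge 0:\gamma+mp\in D(\mu)_R\},$$ $$D(\mu)_\gamma=\{(\beta|\beta)\in D(\mu):\beta\equiv\gamma \pmod p\}.$$ Put $d^0_\gamma=|D(\lambda^0)_\gamma|$, $\Omega'=\{\gamma\in\{0,\dots,p-1\}: d^0_\gamma>0\}$, $(\Omega')^*=\{p-1-\gamma:\gamma\in\Omega'\}$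 and $\Omega''=\{0,\dots,p-1\}\setminus(\Omega'\cup(\Omega')^*)$. Then there is exactly one symmetric partition $\bar\lambda$ with empty $p$-core and with the same $p$-quotient as $\lambda$. Put, for $\gamma'\in\Omega'$, $$S_{\gamma'}(\bar\lambda)_L=\{s: 0\le s\le d^0_{\gamma'}-1,\ s\notin D_{\gamma'}(\bar\lambda)_L\},\qquad T_{\gamma'}(\bar\lambda)_L=\{t\in D_{\gamma'}(\bar\lambda)_L: t\ge d^0_{\gamma'}\}.$$ Then $$\delta(\lambda)=\mathbb O_1\cup\mathbb O_2\cup\mathbb O_3\cup\mathbb O_4,$$ where $$\mathbb O_1=\bigcup_{\gamma'\in\Omega'}\{2(\gamma'+(\sigma+d^0_{\gamma'})p)+1:\sigma\in D_{\gamma'}(\bar\lambda)_R\},$$ $$\mathbb O_2=\bigcup_{\gamma'\in\Omega'}\{2(\gamma'+(d^0_{\gamma'}-s-1)p)+1: s\in S_{\gamma'}(\bar\lambda)_L\},$$ $$\mathbb O_3=\bigcup_{\gamma'\in\Omega'}\{2((p-1-\gamma')+(t-d^0_{\gamma'})p)+1: t\in T_{\gamma'}(\bar\lambda)_L\},$$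 $$\mathbb O_4=\bigcup_{\gamma''\in\Omega''}\{2(\gamma''+\mu p)+1:\mu\in D_{\gamma''}(\bar\lambda)_R\}.$$ (If $\lambda^0$ is empty, then $\Omega'=\emptyset$ and only $\mathbb O_4$, with $\bar\lambda=\lambda$, remains.) -/

import Mathlib

/-
Partitions are Mathlib's `YoungDiagram`s (rows and columns are numbered from `0`), the dual of a
partition is `YoungDiagram.transpose`, and the empty partition is `⊥`.
-/
namespace DiagHooks

open Finset

/-! ### Hooks and the bisequence of a partition -/

/-- Arm length of the hook of `lam` with corner `c` (meant for `c ∈ lam`). -/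
def armLength (lam : YoungDiagram) (c : ℕ × ℕ) : ℕ := lam.rowLen c.1 - (c.2 + 1)

/-- Leg length of the hook of `lam` with corner `c` (meant for `c ∈ lam`). -/
def legLength (lam : YoungDiagram) (c : ℕ × ℕ) : ℕ := lam.colLen c.2 - (c.1 + 1)

/-- Hook length of the hook of `lam` with corner `c` (meant for `c ∈ lam`). -/
def hookLength (lam : YoungDiagram) (c : ℕ × ℕ) : ℕ := armLength lam c + legLength lam c + 1

/-- The diagonal nodes `(i, i)` of `lam`. -/
def diagCells (lam : YoungDiagram) : Finset (ℕ × ℕ) := lam.cells.filter fun c => c.1 = c.2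

/-- `δ(lam)`, the set of diagonal hook lengths of `lam`. -/
def diagHookLengths (lam : YoungDiagram) : Finset ℕ := (diagCells lam).image (hookLength lam)

/-- `D(lam)`, the bisequence of `lam`, as the set of its elements `(α | β)`: the pairs of the leg
length `α` and the arm length `β` of a diagonal hook. Both components are strictly decreasing along
the diagonal, so the set determines the two sequences. -/
def bisequence (lam : YoungDiagram) : Finset (ℕ × ℕ) :=
  (diagCells lam).image fun c => (legLength lam c, armLength lam c)

/-- The component `D(lam)_L`, the leg lengths of the diagonal hooks. -/
def bisequenceL (lam : YoungDiagram) : Finset ℕ := (bisequence lam).image Prod.fst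

/-- The component `D(lam)_R`, the arm lengths of the diagonal hooks. -/
def bisequenceR (lam : YoungDiagram) : Finset ℕ := (bisequence lam).image Prod.snd

/-- `D_γ(lam)_L` for `0 ≤ γ ≤ p - 1`, the left component of the `γ`-th entry of the `p`-quotient
`D'(lam)` of `D(lam)`: it contains `m` exactly when `(p - 1 - γ) + m p` lies in `D(lam)_L`. -/
def quotientL (p : ℕ) (lam : YoungDiagram) (γ : ℕ) : Finset ℕ :=
  ((bisequenceL lam).filter fun α => α % p = p - 1 - γ).image fun α => α / p

/-- `D_γ(lam)_R` for `0 ≤ γ ≤ p - 1`, the right component of the `γ`-th entry of the `p`-quotient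
`D'(lam)` of `D(lam)`: it contains `m` exactly when `γ + m p` lies in `D(lam)_R`. -/
def quotientR (p : ℕ) (lam : YoungDiagram) (γ : ℕ) : Finset ℕ :=
  ((bisequenceR lam).filter fun β => β % p = γ).image fun β => β / p

/-- `D(lam)_γ`, the elements `(β | β)` of `D(lam)` with `β ≡ γ` modulo `p` (for `γ < p`). -/
def residuePart (p : ℕ) (lam : YoungDiagram) (γ : ℕ) : Finset (ℕ × ℕ) :=
  (bisequence lam).filter fun q => q.1 = q.2 ∧ q.2 % p = γ

/-! ### `β`-sets, `p`-cores and `p`-quotients of partitions -/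

/-- The `β`-set of `lam` with `k` elements, where `k` is at least the number of parts of `lam`:
the numbers `lam_i + (k - i)` for `1 ≤ i ≤ k` in the usual numbering of the parts. -/
def betaSet (lam : YoungDiagram) (k : ℕ) : Finset ℕ :=
  (range k).image fun i => lam.rowLen i + (k - 1 - i)

/-- The partition represented by the finite `β`-set `X`: its parts are the numbers of spaces
(non-elements of `X`) below the elements of `X`, in decreasing order. So there is a node `(i, j)`
exactly when some `x ∈ X` has at least `i` elements of `X` above it and more than `j` spaces
below it. -/
def ofBetaSet (X : Finset ℕ) : YoungDiagram where
  cells := (range #X ×ˢ range (X.sup id)).filter fun c =>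
    ∃ x ∈ X, c.1 ≤ #{z ∈ X | x < z} ∧ c.2 < #{y ∈ range x | y ∉ X}
  isLowerSet := by
    rintro ⟨i, j⟩ ⟨i', j'⟩ ⟨hi, hj⟩ h
    simp only [coe_filter, mem_product, mem_range, Set.mem_ofPred_eq] at h hi hj ⊢
    obtain ⟨⟨h1, h2⟩, x, hx, h3, h4⟩ := h
    exact ⟨⟨by omega, by omega⟩, x, hx, by omega, by omega⟩

/-- The removal of a `p`-hook `(x - p, x]` from a `β`-set lowers the sum of its elements. -/
theorem removeHook_sum_lt {p x : ℕ} {X : Finset ℕ} (hx : x ∈ X) (hpx : p ≤ x) (hy : x - p ∉ X) :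
    ∑ z ∈ insert (x - p) (X.erase x), z < ∑ z ∈ X, z := by
  have hp : p ≠ 0 := by
    rintro rfl
    exact hy hx
  have h1 : x - p ∉ X.erase x := fun h => hy (mem_of_mem_erase h)
  rw [sum_insert h1, ← add_sum_erase X (fun z => z) hx]
  omega

/-- The `β`-set obtained from `X` by successively removing `p`-hooks `(x - p, x]`, that is, by
replacing an element `x` of the set by a non-element `x - p ≥ 0`, until there are none left. (The
result does not depend on the order; here the hook with the smallest `x` is removed first.) -/
def coreBetaSet (p : ℕ) (X : Finset ℕ) : Finset ℕ :=
  if h : ∃ x ∈ X, p ≤ x ∧ x - p ∉ X then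
    coreBetaSet p (insert (Nat.find h - p) (X.erase (Nat.find h)))
  else X
termination_by ∑ x ∈ X, x
decreasing_by
  exact removeHook_sum_lt (Nat.find_spec h).1 (Nat.find_spec h).2.1 (Nat.find_spec h).2.2

/-- The `p`-core of `lam`. -/
def core (p : ℕ) (lam : YoungDiagram) : YoungDiagram :=
  ofBetaSet (coreBetaSet p (betaSet lam (lam.colLen 0)))

/-- `X_γ = {j : γ + j p ∈ X}` for `γ < p`, the positions of the beads of `X` on the `γ`-th runner
of the `p`-abacus. -/
def runner (p : ℕ) (X : Finset ℕ) (γ : ℕ) : Finset ℕ :=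
  (X.filter fun x => x % p = γ).image fun x => x / p

/-- The `γ`-th entry `lam_γ` of the `p`-quotient of `lam`, for `γ < p`: the partition represented
by `X_γ`, where `X` is a `β`-set of `lam` whose number of elements is divisible by `p`. -/
def quotient (p : ℕ) (lam : YoungDiagram) (γ : ℕ) : YoungDiagram :=
  ofBetaSet (runner p (betaSet lam (p * lam.colLen 0)) γ)

/-- `bar` is the partition that the formula uses in place of `lam`: it is symmetric, it has empty
`p`-core and it has the same `p`-quotient as `lam`. -/
structure IsBar (p : ℕ) (lam bar : YoungDiagram) : Prop where
  symmetric : bar.transpose = bar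
  core_eq : core p bar = ⊥
  quotient_eq : ∀ γ < p, quotient p bar γ = quotient p lam γ

/-! ### The data of the formula -/

/-- `d⁰_γ = |D(lam⁰)_γ|`, where `lam⁰` is the `p`-core of `lam`. -/
def d0 (p : ℕ) (lam : YoungDiagram) (γ : ℕ) : ℕ := #(residuePart p (core p lam) γ)

/-- `Ω'`, the set of `γ ∈ {0, …, p - 1}` with `d⁰_γ > 0`. -/
def Omega1 (p : ℕ) (lam : YoungDiagram) : Finset ℕ := (range p).filter fun γ => 0 < d0 p lam γ

/-- `Ω'' = {0, …, p - 1} - (Ω' ∪ (Ω')*)`, where `(Ω')* = {p - 1 - γ : γ ∈ Ω'}`. -/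
def Omega2 (p : ℕ) (lam : YoungDiagram) : Finset ℕ :=
  range p \ (Omega1 p lam ∪ (Omega1 p lam).image fun γ => p - 1 - γ)

/-- `S_γ(bar)_L`, the set of `s ∉ D_γ(bar)_L` with `0 ≤ s ≤ d - 1`, where `d = d⁰_γ`. -/
def setS (p : ℕ) (bar : YoungDiagram) (γ d : ℕ) : Finset ℕ :=
  (range d).filter fun s => s ∉ quotientL p bar γ

/-- `T_γ(bar)_L`, the set of `t ∈ D_γ(bar)_L` with `t ≥ d`, where `d = d⁰_γ`. -/
def setT (p : ℕ) (bar : YoungDiagram) (γ d : ℕ) : Finset ℕ :=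
  (quotientL p bar γ).filter fun t => d ≤ t

end DiagHooks

/-! A partition is encoded by its Maya diagram M, the set of integers `lam_i - i - 1`. Duality
becomes reflection and complement, so `lam` is symmetric exactly when x ∈ M ↔ -1 - x ∉ M. The
nonnegative b ∈ M are then the common arm and leg lengths of the diagonal hooks, and `δ(lam)`
consists of the numbers 2b + 1.

Split M into the runners γ + jp. Each has a charge c_γ: the core has the positions j < c_γ on it,
and the runner itself is the Maya diagram of the quotient entry moved by c_γ
(`exists_runner_charge`). Reflection exchanges the runners γ and p - 1 - γ, so their charges are
opposite (`charge_dual`), and d⁰_γ = max(c_γ, 0). The partition `bar` has the same quotient and all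
charges 0, so its position j corresponds to position j + c_γ of `lam`.

The formula sorts the b = γ + jp ∈ M with j ≥ 0 by the sign of c_γ. If c_γ > 0, the positions j ≥
c_γ give O₁, and those with j < c_γ, read off the dual runner by reflection, give O₂. If c_γ < 0,
the dual residue lies in Ω' and the runner gives O₃. If c_γ = 0, nothing moves and the runner gives
O₄. -/

namespace DiagHooks

open Finset

/-! ### Maya diagrams -/

/-- The Maya diagram of a partition: the integers `lam_i - i - 1` for `i ≥ 0`. -/
def maya (lam : YoungDiagram) : Set ℤ := Set.range fun i : ℕ => (lam.rowLen i : ℤ) - i - 1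

/-- The set of integers represented by a finite `β`-set `X` of which `k` is the origin. -/
def beads (X : Finset ℕ) (k : ℤ) : Set ℤ := {x | x + k < 0 ∨ ∃ n ∈ X, (n : ℤ) = x + k}

theorem mem_maya {lam : YoungDiagram} {x : ℤ} :
    x ∈ maya lam ↔ ∃ i : ℕ, (lam.rowLen i : ℤ) - i - 1 = x := Iff.rfl

theorem mem_beads {X : Finset ℕ} {k x : ℤ} :
    x ∈ beads X k ↔ x + k < 0 ∨ ∃ n ∈ X, (n : ℤ) = x + k := Iff.rfl

theorem rowLen_eq_zero_of_colLen_le {lam : YoungDiagram} {i : ℕ} (h : lam.colLen 0 ≤ i) :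
    lam.rowLen i = 0 := by
  by_contra h0
  have : (i, 0) ∈ lam := YoungDiagram.mem_iff_lt_rowLen.2 (Nat.pos_of_ne_zero h0)
  exact absurd (YoungDiagram.mem_iff_lt_colLen.1 this) (by omega)

/-- The negated values strictly increase with the row, and a strictly increasing sequence is
determined by its range. -/
theorem maya_injective : Function.Injective maya := by
  intro lam mu h
  have hs : ∀ nu : YoungDiagram, StrictMono fun i : ℕ => (i : ℤ) + 1 - nu.rowLen i := by
    intro nu
    refine strictMono_nat_of_lt_succ fun i => ?_
    have := nu.rowLen_anti i (i + 1) (by omega)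
    push_cast
    omega
  have hr : ∀ nu : YoungDiagram,
      Set.range (fun i : ℕ => (i : ℤ) + 1 - nu.rowLen i) = {x | -x ∈ maya nu} := by
    intro nu
    ext x
    simp only [Set.mem_range, Set.mem_ofPred_eq, mem_maya]
    exact exists_congr fun i => by constructor <;> intro h <;> omega
  have h2 : (fun i : ℕ => (i : ℤ) + 1 - lam.rowLen i) = fun i : ℕ => (i : ℤ) + 1 - mu.rowLen i := by
    rw [← StrictMono.range_inj (hs lam) (hs mu), hr, hr, h]
  ext ⟨i, j⟩
  have h3 : (i : ℤ) + 1 - lam.rowLen i = (i : ℤ) + 1 - mu.rowLen i := congrFun h2 i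
  rw [YoungDiagram.mem_cells, YoungDiagram.mem_cells, YoungDiagram.mem_iff_lt_rowLen,
    YoungDiagram.mem_iff_lt_rowLen]
  omega

theorem mem_maya_transpose {lam : YoungDiagram} {x : ℤ} :
    x ∈ maya lam.transpose ↔ -1 - x ∉ maya lam := by
  have key : ∀ i j : ℕ, j < lam.rowLen i ↔ i < lam.colLen j := fun i j => by
    rw [← YoungDiagram.mem_iff_lt_rowLen, YoungDiagram.mem_iff_lt_colLen]
  simp only [mem_maya, YoungDiagram.rowLen_transpose]
  constructor
  · rintro ⟨j, rfl⟩ ⟨i, hi⟩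
    have := key i j
    omega
  · intro h
    push Not at h
    have hex : ∃ i : ℕ, (lam.rowLen i : ℤ) - i - 1 < -1 - x := by
      refine ⟨lam.colLen 0 + x.toNat + 1, ?_⟩
      rw [rowLen_eq_zero_of_colLen_le (by omega)]
      push_cast
      omega
    classical
    obtain ⟨i, hi, hmin⟩ : ∃ i : ℕ, (lam.rowLen i : ℤ) - i - 1 < -1 - x ∧
        ∀ i' < i, ¬ (lam.rowLen i' : ℤ) - i' - 1 < -1 - x :=
      ⟨Nat.find hex, Nat.find_spec hex, fun i' h' => Nat.find_min hex h'⟩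
    -- With i the first row whose value is below -1 - x, the column j sought has length i, and x = i
    -- - j - 1 forces this j.
    refine ⟨(-1 - x + i).toNat, ?_⟩
    have h1 := key i (-1 - x + i).toNat
    rcases Nat.eq_zero_or_pos i with rfl | hpos
    · omega
    · have h2 := key (i - 1) (-1 - x + i).toNat
      have h3 := hmin (i - 1) (by omega)
      have h4 := h (i - 1)
      omega

theorem transpose_eq_self_iff {lam : YoungDiagram} :
    lam.transpose = lam ↔ ∀ x, x ∈ maya lam ↔ -1 - x ∉ maya lam := by
  refine ⟨fun h x => ?_, fun h => maya_injective ?_⟩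
  · rw [← mem_maya_transpose, h]
  · ext x
    rw [mem_maya_transpose, h x]

theorem maya_bot : maya ⊥ = {x | x < 0} := by
  ext x
  have h : ∀ i, (⊥ : YoungDiagram).rowLen i = 0 := fun i => by
    by_contra h0
    exact YoungDiagram.notMem_bot (i, 0)
      (YoungDiagram.mem_iff_lt_rowLen.2 (Nat.pos_of_ne_zero h0))
  simp only [mem_maya, h, Set.mem_ofPred_eq]
  refine ⟨?_, fun hx => ⟨(-1 - x).toNat, ?_⟩⟩
  · rintro ⟨i, rfl⟩
    omega
  · omega

/-! ### `β`-sets -/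

theorem maya_eq_beads_betaSet {lam : YoungDiagram} {k : ℕ} (hk : lam.colLen 0 ≤ k) :
    maya lam = beads (betaSet lam k) k := by
  ext x
  simp only [mem_maya, mem_beads, betaSet, mem_image, mem_range]
  constructor
  · rintro ⟨i, rfl⟩
    by_cases hi : i < k
    · exact Or.inr ⟨_, ⟨i, hi, rfl⟩, by omega⟩
    · rw [rowLen_eq_zero_of_colLen_le (by omega : lam.colLen 0 ≤ i)]
      omega
  · rintro (h | ⟨n, ⟨i, hi, rfl⟩, h⟩)
    · refine ⟨(-1 - x).toNat, ?_⟩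
      rw [rowLen_eq_zero_of_colLen_le (by omega)]
      omega
    · exact ⟨i, by omega⟩

theorem card_betaSet (lam : YoungDiagram) (k : ℕ) : #(betaSet lam k) = k := by
  rw [betaSet, card_image_of_injOn, card_range]
  intro i hi j hj h
  simp only [coe_range, Set.mem_Iio] at hi hj h
  rcases lt_trichotomy i j with h1 | h1 | h1
  · have := lam.rowLen_anti i j h1.le
    omega
  · exact h1
  · have := lam.rowLen_anti j i h1.le
    omega

/-- Elements of a finite set below, at and above one of its elements. -/
theorem card_below_add_card_above {X : Finset ℕ} {x : ℕ} (hx : x ∈ X) :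
    #{y ∈ X | y < x} + 1 + #{z ∈ X | x < z} = #X := by
  have h1 : #{y ∈ X | y ≤ x} + #{y ∈ X | ¬ y ≤ x} = #X := card_filter_add_card_filter_not _
  have h2 : ({y ∈ X | y ≤ x} : Finset ℕ) = insert x {y ∈ X | y < x} := by
    ext y
    simp only [mem_filter, mem_insert]
    constructor
    · rintro ⟨h, h'⟩
      rcases h'.eq_or_lt with rfl | h'
      · exact Or.inl rfl
      · exact Or.inr ⟨h, h'⟩
    · rintro (rfl | ⟨h, h'⟩)
      · exact ⟨hx, le_rfl⟩
      · exact ⟨h, h'.le⟩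
  rw [h2, card_insert_of_notMem (by simp)] at h1
  simp only [not_le] at h1
  exact h1

theorem card_below_add_card_spaces (X : Finset ℕ) (x : ℕ) :
    #{y ∈ X | y < x} + #{y ∈ range x | y ∉ X} = x := by
  have h1 : #{y ∈ range x | y ∈ X} + #{y ∈ range x | y ∉ X} = #(range x) :=
    card_filter_add_card_filter_not _
  rw [card_range] at h1
  have h2 : ({y ∈ X | y < x} : Finset ℕ) = {y ∈ range x | y ∈ X} := by
    ext y
    simp only [mem_filter, mem_range, and_comm]
  rw [h2, h1]

theorem mem_ofBetaSet {X : Finset ℕ} {i j : ℕ} :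
    (i, j) ∈ ofBetaSet X ↔ ∃ x ∈ X, i ≤ #{z ∈ X | x < z} ∧ j < #{y ∈ range x | y ∉ X} := by
  rw [← YoungDiagram.mem_cells]
  simp only [ofBetaSet, mem_filter, mem_product, mem_range, and_iff_right_iff_imp]
  rintro ⟨x, hx, h1, h2⟩
  have h3 := card_below_add_card_above hx
  have h4 := card_below_add_card_spaces X x
  have h5 : x ≤ X.sup id := le_sup (f := id) hx
  omega

/-- An element with at least as many elements above it as x is at most x, hence has no more spaces
below it. -/
theorem rowLen_ofBetaSet {X : Finset ℕ} {x : ℕ} (hx : x ∈ X) :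
    (ofBetaSet X).rowLen #{z ∈ X | x < z} = #{y ∈ range x | y ∉ X} := by
  refine eq_of_forall_lt_iff fun j => ?_
  rw [← YoungDiagram.mem_iff_lt_rowLen, mem_ofBetaSet]
  refine ⟨?_, fun h => ⟨x, hx, le_rfl, h⟩⟩
  rintro ⟨y, hy, h1, h2⟩
  refine h2.trans_le (card_le_card (filter_subset_filter _ (range_subset_range.2 ?_)))
  by_contra! hlt
  refine absurd h1 (not_le.2 (card_lt_card ?_))
  rw [ssubset_iff_of_subset (fun z hz => by simp only [mem_filter] at hz ⊢; exact ⟨hz.1, by omega⟩)]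
  exact ⟨y, by simp [hy, hlt], by simp⟩

/-- Counting the elements above is injective on X with values below #X, hence onto by cardinality.
-/
theorem exists_card_above_eq {X : Finset ℕ} {i : ℕ} (hi : i < #X) :
    ∃ x ∈ X, #{z ∈ X | x < z} = i := by
  have himg : X.image (fun x => #{z ∈ X | x < z}) = range #X := by
    refine eq_of_subset_of_card_le ?_ ?_
    · intro i hi
      obtain ⟨x, hx, rfl⟩ := mem_image.1 hi
      have := card_below_add_card_above hx
      exact mem_range.2 (by omega)
    · rw [card_range, card_image_of_injOn]
      have key : ∀ x ∈ X, ∀ y ∈ X, x < y → #{z ∈ X | y < z} < #{z ∈ X | x < z} := by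
        intro x hx y hy hlt
        refine card_lt_card ?_
        rw [ssubset_iff_of_subset
          (fun z hz => by simp only [mem_filter] at hz ⊢; exact ⟨hz.1, by omega⟩)]
        exact ⟨y, by simp [hy, hlt], by simp⟩
      intro x hx y hy h
      simp only at h
      rcases lt_trichotomy x y with h1 | h1 | h1
      · have := key x hx y hy h1
        omega
      · exact h1
      · have := key y hy x hx h1
        omega
  have := himg ▸ mem_range.2 hi
  exact mem_image.1 this

theorem maya_ofBetaSet (X : Finset ℕ) : maya (ofBetaSet X) = beads X #X := by
  have hval : ∀ x ∈ X, ((ofBetaSet X).rowLen #{z ∈ X | x < z} : ℤ) - #{z ∈ X | x < z} - 1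
      = x - #X := by
    intro x hx
    have h3 := card_below_add_card_above hx
    have h4 := card_below_add_card_spaces X x
    rw [rowLen_ofBetaSet hx]
    omega
  have hzero : ∀ i, #X ≤ i → (ofBetaSet X).rowLen i = 0 := by
    intro i hi
    by_contra h0
    obtain ⟨x, hx, h1, -⟩ := mem_ofBetaSet.1
      (YoungDiagram.mem_iff_lt_rowLen.2 (Nat.pos_of_ne_zero h0) : (i, 0) ∈ ofBetaSet X)
    have h3 := card_below_add_card_above hx
    omega
  ext x
  rw [mem_maya, mem_beads]
  constructor
  · rintro ⟨i, rfl⟩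
    by_cases hi : i < #X
    · obtain ⟨x, hx, rfl⟩ := exists_card_above_eq hi
      exact Or.inr ⟨x, hx, by rw [hval x hx]; ring⟩
    · rw [hzero i (by omega)]
      omega
  · rintro (h | ⟨n, hn, h⟩)
    · refine ⟨(-1 - x).toNat, ?_⟩
      rw [hzero _ (by omega)]
      omega
    · exact ⟨_, (hval n hn).trans (by omega)⟩

/-! ### Charges -/

theorem beads_eq_beads_add (X : Finset ℕ) (k : ℤ) (m : ℕ) :
    ∃ Y : Finset ℕ, beads X k = beads Y (k + m) ∧ #Y = #X + m := by
  -- Moving the origin down by m turns m of the implicit negative beads into the explicit beads 0,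
  -- …, m - 1.
  refine ⟨X.image (· + m) ∪ range m, ?_, ?_⟩
  · ext x
    simp only [mem_beads, mem_union, mem_image, mem_range]
    constructor
    · rintro (h | ⟨n, hn, h⟩)
      · by_cases h' : x + (k + m) < 0
        · exact Or.inl h'
        · exact Or.inr ⟨(x + (k + m)).toNat, Or.inr (by omega), by omega⟩
      · exact Or.inr ⟨n + m, Or.inl ⟨n, hn, rfl⟩, by push_cast; omega⟩
    · rintro (h | ⟨_, ⟨n, hn, rfl⟩ | hn, h⟩)
      · omega
      · exact Or.inr ⟨n, hn, by push_cast at h; omega⟩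
      · omega
  · rw [card_union_of_disjoint, card_image_of_injective _ (add_left_injective m), card_range]
    rw [disjoint_left]
    intro a ha hb
    obtain ⟨n, -, rfl⟩ := mem_image.1 ha
    have := mem_range.1 hb
    omega

theorem beads_left_injective {X Y : Finset ℕ} {k : ℤ} (h : beads X k = beads Y k) : X = Y := by
  have key : ∀ (Z : Finset ℕ) (n : ℕ), n ∈ Z ↔ (n : ℤ) - k ∈ beads Z k := by
    intro Z n
    rw [mem_beads]
    refine ⟨fun hn => Or.inr ⟨n, hn, by ring⟩, ?_⟩
    rintro (h | ⟨m, hm, h⟩)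
    · omega
    · rwa [(by omega : n = m)]
  ext n
  rw [key X, key Y, h]

/-- The charge `#X - k` depends only on the set of integers. -/
theorem charge_unique {X Y : Finset ℕ} {k l : ℤ} (h : beads X k = beads Y l) :
    (#X : ℤ) - k = #Y - l := by
  wlog hkl : k ≤ l generalizing X Y k l
  · exact (this h.symm (by omega)).symm
  obtain ⟨m, rfl⟩ : ∃ m : ℕ, l = k + m := ⟨(l - k).toNat, by omega⟩
  obtain ⟨Z, hZ, hc⟩ := beads_eq_beads_add X k m
  obtain rfl := beads_left_injective (hZ.symm.trans h)
  omega

/-- Maya diagrams of partitions have charge 0, while a translation by c changes the charge by c. -/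
theorem eq_zero_of_maya_shift {lam mu : YoungDiagram} {c : ℤ}
    (h : ∀ j, j ∈ maya lam ↔ j + c ∈ maya mu) : c = 0 := by
  have h1 : beads (betaSet lam (lam.colLen 0)) (lam.colLen 0) =
      beads (betaSet mu (mu.colLen 0)) (mu.colLen 0 + c) := by
    ext j
    rw [← maya_eq_beads_betaSet le_rfl, h j, maya_eq_beads_betaSet le_rfl]
    simp only [mem_beads, add_assoc, add_comm c]
  have h2 := charge_unique h1
  rw [card_betaSet, card_betaSet] at h2
  omega

/-! ### Runners, cores and quotients -/

theorem mem_runner {p : ℕ} {X : Finset ℕ} {γ j : ℕ} (hγ : γ < p) :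
    j ∈ runner p X γ ↔ γ + j * p ∈ X := by
  simp only [runner, mem_image, mem_filter]
  constructor
  · rintro ⟨x, ⟨hx, rfl⟩, rfl⟩
    rwa [mul_comm, Nat.mod_add_div]
  · intro h
    refine ⟨_, ⟨h, ?_⟩, ?_⟩
    · rw [Nat.add_mul_mod_self_right, Nat.mod_eq_of_lt hγ]
    · rw [Nat.add_mul_div_right _ _ (by omega), Nat.div_eq_of_lt hγ, zero_add]

theorem card_runner (p : ℕ) (X : Finset ℕ) (γ : ℕ) :
    #(runner p X γ) = #{x ∈ X | x % p = γ} := by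
  refine card_image_of_injOn fun x hx y hy h => ?_
  simp only [coe_filter, Set.mem_ofPred_eq] at hx hy h
  rw [← Nat.mod_add_div x p, ← Nat.mod_add_div y p, hx.2, hy.2, h]

/-- An origin k not divisible by p permutes the runners cyclically. This is needed because `core`
and `quotient` use β-sets of different sizes. -/
theorem mem_beads_runner {p : ℕ} (hp : 0 < p) (X : Finset ℕ) (k γ : ℕ) (j : ℤ) :
    γ + j * p ∈ beads X k ↔ j ∈ beads (runner p X ((γ + k) % p)) ((γ + k) / p : ℕ) := by
  have hr := Nat.mod_lt (γ + k) hp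
  have hd : ((γ + k : ℕ) : ℤ) = ((γ + k) % p : ℕ) + p * ((γ + k) / p : ℕ) := by
    exact_mod_cast (Nat.mod_add_div (γ + k) p).symm
  have he : (γ : ℤ) + j * p + k = ((γ + k) % p : ℕ) + (j + ((γ + k) / p : ℕ)) * p := by
    push_cast at hd ⊢
    linear_combination hd
  rw [mem_beads, mem_beads, he]
  generalize (γ + k) % p = r at *
  generalize ((γ + k) / p : ℕ) = q at *
  refine or_congr ?_ ?_
  · constructor
    · intro h
      by_contra! h'
      nlinarith
    · intro h
      nlinarith
  · constructor
    · rintro ⟨n, hn, h⟩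
      have hj : 0 ≤ j + q := by
        by_contra! h'
        nlinarith
      refine ⟨(j + q).toNat, ?_, by omega⟩
      rw [mem_runner hr]
      convert hn
      zify
      rw [h, Int.toNat_of_nonneg hj]
    · rintro ⟨n, hn, h⟩
      rw [mem_runner hr] at hn
      exact ⟨_, hn, by push_cast; rw [h]⟩

/-- Removing a p-hook moves one bead within its residue class, so the counts survive; at the end no
bead can move down. -/
theorem coreBetaSet_spec (p : ℕ) (X : Finset ℕ) :
    #(coreBetaSet p X) = #X ∧ (∀ r, #(runner p (coreBetaSet p X) r) = #(runner p X r)) ∧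
      ∀ x ∈ coreBetaSet p X, p ≤ x → x - p ∈ coreBetaSet p X := by
  induction X using coreBetaSet.induct p with
  | case1 X h ih =>
    rw [coreBetaSet, dif_pos h]
    obtain ⟨hx, hpx, hy⟩ := Nat.find_spec h
    generalize Nat.find h = x at *
    have hc : ∀ Q : ℕ → Prop, ∀ [DecidablePred Q], (Q (x - p) ↔ Q x) →
        #{z ∈ insert (x - p) (X.erase x) | Q z} = #{z ∈ X | Q z} := by
      intro Q _ hQ
      rw [filter_insert, filter_erase]
      by_cases hq : Q x
      · rw [if_pos (hQ.2 hq), card_insert_of_notMem, card_erase_add_one]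
        · exact mem_filter.2 ⟨hx, hq⟩
        · exact fun h' => hy (mem_filter.1 (mem_of_mem_erase h')).1
      · rw [if_neg (mt hQ.1 hq), erase_eq_of_notMem]
        exact fun h' => hq (mem_filter.1 h').2
    obtain ⟨h1, h2, h3⟩ := ih
    refine ⟨?_, fun r => ?_, h3⟩
    · rw [h1]
      simpa using hc (fun _ => True) Iff.rfl
    · rw [h2, card_runner, card_runner]
      refine hc _ ?_
      rw [Nat.mod_eq_sub_mod hpx]
  | case2 X h =>
    rw [coreBetaSet, dif_neg h]
    refine ⟨rfl, fun _ => rfl, fun x hx hpx => ?_⟩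
    by_contra hy
    exact h ⟨x, hx, hpx, hy⟩

theorem runner_coreBetaSet {p : ℕ} (X : Finset ℕ) {r : ℕ} (hr : r < p) :
    runner p (coreBetaSet p X) r = range #(runner p X r) := by
  obtain ⟨-, h2, h3⟩ := coreBetaSet_spec p X
  rw [← h2 r]
  have hstep : ∀ j, j + 1 ∈ runner p (coreBetaSet p X) r → j ∈ runner p (coreBetaSet p X) r := by
    intro j hj
    rw [mem_runner hr] at hj ⊢
    have := h3 _ hj (by nlinarith)
    convert this using 1
    rw [add_mul, one_mul, ← add_assoc, Nat.add_sub_cancel]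
  generalize runner p (coreBetaSet p X) r = R at *
  have hlow : ∀ m j, j + m ∈ R → j ∈ R := by
    intro m
    induction m with
    | zero => exact fun j h => h
    | succ m ih => exact fun j h => ih j (hstep _ h)
  refine eq_of_subset_of_card_le (fun j hj => mem_range.2 ?_) (by rw [card_range])
  have : range (j + 1) ⊆ R := fun i hi => by
    have := mem_range.1 hi
    exact hlow (j - i) i (by rwa [Nat.add_sub_cancel' (by omega)])
  have := card_le_card this
  rw [card_range] at this
  omega

/-- Every runner of a partition has a charge `c`, which gives the runner of the `p`-core, and the
runner is the Maya diagram of the entry of the `p`-quotient moved by `c`. -/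
theorem exists_runner_charge {p : ℕ} (lam : YoungDiagram) {γ : ℕ} (hγ : γ < p) :
    ∃ c : ℤ, (∀ j : ℤ, γ + j * p ∈ maya (core p lam) ↔ j < c) ∧
      ∀ j : ℤ, j ∈ maya (quotient p lam γ) ↔ γ + (j + c) * p ∈ maya lam := by
  have hp : 0 < p := by omega
  obtain ⟨k, hk⟩ : ∃ k, k = lam.colLen 0 := ⟨_, rfl⟩
  have hr := Nat.mod_lt (γ + k) hp
  have hA : ∀ j : ℤ, γ + j * p ∈ maya lam ↔
      j ∈ beads (runner p (betaSet lam k) ((γ + k) % p)) ((γ + k) / p : ℕ) := fun j => by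
    rw [← mem_beads_runner hp, maya_eq_beads_betaSet hk.ge]
  have hB : ∀ j : ℤ, γ + j * p ∈ maya lam ↔
      j ∈ beads (runner p (betaSet lam (p * k)) γ) k := fun j => by
    rw [maya_eq_beads_betaSet (k := p * k) (by nlinarith), mem_beads_runner hp,
      Nat.add_mul_mod_self_left, Nat.mod_eq_of_lt hγ, Nat.add_mul_div_left _ _ hp,
      Nat.div_eq_of_lt hγ, zero_add]
  -- The β-sets with k and with pk elements describe the same runner, so they give the same charge:
  -- the first yields the core, the second the quotient.
  have hc := charge_unique (Set.ext fun j => (hA j).symm.trans (hB j))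
  refine ⟨#(runner p (betaSet lam k) ((γ + k) % p)) - ((γ + k) / p : ℕ), fun j => ?_, fun j => ?_⟩
  · rw [core, ← hk, maya_ofBetaSet, (coreBetaSet_spec _ _).1, card_betaSet, mem_beads_runner hp,
      runner_coreBetaSet _ hr, mem_beads]
    simp only [mem_range]
    constructor
    · rintro (h | ⟨n, hn, h⟩) <;> omega
    · intro h
      by_cases h' : j + ((γ + k) / p : ℕ) < 0
      · exact Or.inl h'
      · exact Or.inr ⟨(j + ((γ + k) / p : ℕ)).toNat, by omega, by omega⟩
  · rw [hB, hc, quotient, ← hk, maya_ofBetaSet, mem_beads, mem_beads]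
    have e : j + ((#(runner p (betaSet lam (p * k)) γ) : ℤ) - k) + k =
        j + #(runner p (betaSet lam (p * k)) γ) := by ring
    rw [e]

/-- Partitions can be assembled from the runners of an abacus all of which have charge `0`. -/
theorem exists_maya_of_runners {p : ℕ} (hp : 0 < p) (mu : ℕ → YoungDiagram) :
    ∃ lam : YoungDiagram, ∀ γ < p, ∀ j : ℤ, γ + j * p ∈ maya lam ↔ j ∈ maya (mu γ) := by
  -- With a common k every runner gets k beads, so #X = pk and each runner has its origin at k, that
  -- is, charge 0.
  set k := (range p).sup fun γ => (mu γ).colLen 0 with hk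
  have hle : ∀ γ < p, (mu γ).colLen 0 ≤ k := fun γ hγ =>
    le_sup (f := fun γ => (mu γ).colLen 0) (mem_range.2 hγ)
  set X := (range p).biUnion fun γ => (betaSet (mu γ) k).image fun j => γ + j * p with hX
  have hmod : ∀ γ < p, ∀ j, (γ + j * p) % p = γ ∧ (γ + j * p) / p = j := fun γ hγ j =>
    ⟨by rw [Nat.add_mul_mod_self_right, Nat.mod_eq_of_lt hγ],
      by rw [Nat.add_mul_div_right _ _ hp, Nat.div_eq_of_lt hγ, zero_add]⟩
  have hrun : ∀ γ < p, runner p X γ = betaSet (mu γ) k := by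
    intro γ hγ
    ext j
    rw [mem_runner hγ, hX]
    simp only [mem_biUnion, mem_range, mem_image]
    constructor
    · rintro ⟨γ', hγ', j', hj', h⟩
      have h1 := hmod γ hγ j
      rw [← h, (hmod γ' hγ' j').1, (hmod γ' hγ' j').2] at h1
      rwa [← h1.1, ← h1.2]
    · exact fun h => ⟨γ, hγ, j, h, rfl⟩
  have hcard : #X = p * k := by
    rw [card_eq_sum_card_fiberwise (f := fun x => x % p) (t := range p)
      (fun x _ => mem_coe.2 (mem_range.2 (Nat.mod_lt x hp)))]
    rw [sum_congr rfl (fun γ hγ => (card_runner p X γ).symm.trans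
      ((congrArg card (hrun γ (mem_range.1 hγ))).trans (card_betaSet _ _)))]
    simp
  refine ⟨ofBetaSet X, fun γ hγ j => ?_⟩
  rw [maya_ofBetaSet, hcard, mem_beads_runner hp, Nat.add_mul_mod_self_left, Nat.mod_eq_of_lt hγ,
    Nat.add_mul_div_left _ _ hp, Nat.div_eq_of_lt hγ, zero_add, hrun γ hγ,
    maya_eq_beads_betaSet (hle γ hγ)]

/-! ### Diagonal hooks of symmetric partitions -/

theorem mem_diagCells {lam : YoungDiagram} {c : ℕ × ℕ} :
    c ∈ diagCells lam ↔ c.1 < lam.rowLen c.1 ∧ c.1 = c.2 := by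
  obtain ⟨i, j⟩ := c
  simp only [diagCells, mem_filter, YoungDiagram.mem_cells, YoungDiagram.mem_iff_lt_rowLen]
  constructor <;> rintro ⟨h, rfl⟩ <;> exact ⟨h, rfl⟩

theorem natCast_mem_maya {lam : YoungDiagram} {b : ℕ} :
    (b : ℤ) ∈ maya lam ↔ ∃ i, i < lam.rowLen i ∧ lam.rowLen i - (i + 1) = b := by
  rw [mem_maya]
  exact exists_congr fun i => by omega

theorem colLen_eq_rowLen {lam : YoungDiagram} (h : lam.transpose = lam) (i : ℕ) :
    lam.colLen i = lam.rowLen i := by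
  rw [← YoungDiagram.rowLen_transpose, h]

theorem mem_bisequence {lam : YoungDiagram} (h : lam.transpose = lam) {a b : ℕ} :
    (a, b) ∈ bisequence lam ↔ a = b ∧ (b : ℤ) ∈ maya lam := by
  simp only [bisequence, mem_image, mem_diagCells, Prod.exists, legLength, armLength,
    Prod.mk.injEq, natCast_mem_maya, colLen_eq_rowLen h]
  constructor
  · rintro ⟨i, _, ⟨hi, rfl⟩, rfl, rfl⟩
    exact ⟨rfl, i, hi, rfl⟩
  · rintro ⟨rfl, i, hi, rfl⟩
    exact ⟨i, i, ⟨hi, rfl⟩, rfl, rfl⟩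

theorem mem_bisequenceL {lam : YoungDiagram} (h : lam.transpose = lam) {a : ℕ} :
    a ∈ bisequenceL lam ↔ (a : ℤ) ∈ maya lam := by
  simp [bisequenceL, mem_bisequence h]

theorem mem_bisequenceR {lam : YoungDiagram} (h : lam.transpose = lam) {b : ℕ} :
    b ∈ bisequenceR lam ↔ (b : ℤ) ∈ maya lam := by
  simp [bisequenceR, mem_bisequence h]

theorem mem_diagHookLengths {lam : YoungDiagram} (h : lam.transpose = lam) {n : ℕ} :
    n ∈ diagHookLengths lam ↔ ∃ b : ℕ, (b : ℤ) ∈ maya lam ∧ 2 * b + 1 = n := by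
  simp only [diagHookLengths, mem_image, mem_diagCells, Prod.exists, hookLength, legLength,
    armLength, natCast_mem_maya, colLen_eq_rowLen h]
  constructor
  · rintro ⟨i, _, ⟨hi, rfl⟩, rfl⟩
    exact ⟨_, ⟨i, hi, rfl⟩, by omega⟩
  · rintro ⟨_, ⟨i, hi, rfl⟩, rfl⟩
    exact ⟨i, i, ⟨hi, rfl⟩, by omega⟩

theorem mem_quotientL {p : ℕ} {lam : YoungDiagram} (h : lam.transpose = lam) {γ m : ℕ}
    (hγ : γ < p) : m ∈ quotientL p lam γ ↔ ((p - 1 - γ : ℕ) : ℤ) + m * p ∈ maya lam := by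
  rw [quotientL, ← runner, mem_runner (by omega), mem_bisequenceL h]
  push_cast
  rfl

theorem mem_quotientR {p : ℕ} {lam : YoungDiagram} (h : lam.transpose = lam) {γ m : ℕ}
    (hγ : γ < p) : m ∈ quotientR p lam γ ↔ (γ : ℤ) + m * p ∈ maya lam := by
  rw [quotientR, ← runner, mem_runner hγ, mem_bisequenceR h]
  push_cast
  rfl

/-- Applied to the core, this identifies d⁰_γ with the positive part of the charge. -/
theorem card_residuePart {p : ℕ} {lam : YoungDiagram} (h : lam.transpose = lam) {γ : ℕ}
    (hγ : γ < p) {c : ℤ} (hc : ∀ j : ℤ, γ + j * p ∈ maya lam ↔ j < c) :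
    #(residuePart p lam γ) = c.toNat := by
  have h1 : runner p (bisequenceR lam) γ = range c.toNat := by
    ext j
    rw [mem_runner hγ, mem_bisequenceR h, mem_range]
    push_cast
    rw [hc]
    omega
  rw [← card_range c.toNat, ← h1, card_runner]
  have h2 : residuePart p lam γ =
      ({b ∈ bisequenceR lam | b % p = γ} : Finset ℕ).image fun b => (b, b) := by
    ext ⟨a, b⟩
    simp only [residuePart, mem_filter, mem_bisequence h, mem_image, mem_bisequenceR h,
      Prod.mk.injEq]
    constructor
    · rintro ⟨⟨rfl, hb⟩, -, hm⟩
      exact ⟨_, ⟨hb, hm⟩, rfl, rfl⟩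
    · rintro ⟨_, ⟨hb, hm⟩, rfl, rfl⟩
      exact ⟨⟨rfl, hb⟩, rfl, hm⟩
  rw [h2, card_image_of_injective _ fun a b hab => (Prod.ext_iff.1 hab).1]

/-! ### The abacus of a symmetric partition -/

/-- Every integer lies on one of the `p` runners. -/
theorem exists_runner {p : ℕ} (hp : 0 < p) (x : ℤ) :
    ∃ γ < p, ∃ j : ℤ, x = γ + j * p := by
  have h1 := Int.emod_nonneg x (by omega : (p : ℤ) ≠ 0)
  have h2 := Int.emod_lt_of_pos x (by omega : (0 : ℤ) < p)
  refine ⟨(x % p).toNat, by omega, x / p, ?_⟩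
  rw [Int.toNat_of_nonneg h1, mul_comm, Int.emod_add_mul_ediv]

/-- The dual of a position on the abacus. -/
theorem neg_one_sub_runner {p γ : ℕ} (hγ : γ < p) (j : ℤ) :
    -1 - ((γ : ℤ) + j * p) = ((p - 1 - γ : ℕ) : ℤ) + (-1 - j) * p := by
  rw [Nat.cast_sub (by omega), Nat.cast_sub (by omega)]
  push_cast
  ring

theorem maya_ext_runner {p : ℕ} (hp : 0 < p) {lam mu : YoungDiagram}
    (h : ∀ γ < p, ∀ j : ℤ, γ + j * p ∈ maya lam ↔ γ + j * p ∈ maya mu) : lam = mu := by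
  refine maya_injective (Set.ext fun x => ?_)
  obtain ⟨γ, hγ, j, rfl⟩ := exists_runner hp x
  exact h γ hγ j

theorem transpose_eq_self_iff_runner {p : ℕ} (hp : 0 < p) {lam : YoungDiagram} :
    lam.transpose = lam ↔ ∀ γ < p, ∀ j : ℤ,
      γ + j * p ∈ maya lam ↔ ((p - 1 - γ : ℕ) : ℤ) + (-1 - j) * p ∉ maya lam := by
  rw [transpose_eq_self_iff]
  refine ⟨fun h γ hγ j => by rw [h, neg_one_sub_runner hγ], fun h x => ?_⟩
  obtain ⟨γ, hγ, j, rfl⟩ := exists_runner hp x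
  rw [neg_one_sub_runner hγ, h γ hγ j]

theorem runner_neg_iff {p γ : ℕ} (hγ : γ < p) (j : ℤ) : (γ : ℤ) + j * p < 0 ↔ j < 0 := by
  constructor
  · intro h
    by_contra! h'
    nlinarith
  · intro h
    nlinarith

/-- On a partition with empty `p`-core the entries of the `p`-quotient are the runners. -/
theorem mem_maya_quotient_of_core_eq_bot {p : ℕ} {bar : YoungDiagram} (h : core p bar = ⊥) {γ : ℕ}
    (hγ : γ < p) (j : ℤ) : j ∈ maya (quotient p bar γ) ↔ γ + j * p ∈ maya bar := by
  obtain ⟨c, h1, h2⟩ := exists_runner_charge bar hγ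
  have h3 : ∀ j : ℤ, j < 0 ↔ j < c := fun j => by
    rw [← h1, h, maya_bot, Set.mem_ofPred_eq, runner_neg_iff hγ]
  obtain rfl : c = 0 := by
    have := h3 c
    have := h3 0
    omega
  rw [h2, add_zero]

/-- The charges of dual runners of a symmetric partition add up to `0`, and the corresponding
entries of the `p`-quotient are dual to each other. -/
theorem charge_dual {p : ℕ} {lam : YoungDiagram} (h : lam.transpose = lam) {γ : ℕ} (hγ : γ < p)
    {c c' : ℤ} (hc : ∀ j : ℤ, j ∈ maya (quotient p lam γ) ↔ γ + (j + c) * p ∈ maya lam)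
    (hc' : ∀ j : ℤ, j ∈ maya (quotient p lam (p - 1 - γ)) ↔
      ((p - 1 - γ : ℕ) : ℤ) + (j + c') * p ∈ maya lam) :
    c' = -c ∧ ∀ j, j ∈ maya (quotient p lam (p - 1 - γ)) ↔ -1 - j ∉ maya (quotient p lam γ) := by
  -- Up to a shift by c + c', the two sides are Maya diagrams of partitions, which forces c + c' =
  -- 0.
  have key : ∀ j, j ∈ maya (quotient p lam (p - 1 - γ)) ↔
      j + (c + c') ∈ maya (quotient p lam γ).transpose := fun j => by
    rw [hc', mem_maya_transpose, hc,
      (transpose_eq_self_iff_runner (by omega)).1 h γ hγ, not_not]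
    ring_nf
  have h0 := eq_zero_of_maya_shift key
  refine ⟨by omega, fun j => ?_⟩
  rw [key, h0, add_zero, mem_maya_transpose]

theorem core_transpose {p : ℕ} (hp : 0 < p) {lam : YoungDiagram} (h : lam.transpose = lam) :
    (core p lam).transpose = core p lam := by
  rw [transpose_eq_self_iff_runner hp]
  intro γ hγ j
  obtain ⟨c, h1, h2⟩ := exists_runner_charge lam hγ
  obtain ⟨c', h1', h2'⟩ := exists_runner_charge lam (by omega : p - 1 - γ < p)
  obtain ⟨rfl, -⟩ := charge_dual h hγ h2 h2'
  rw [h1, h1']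
  omega

/-- Existence: put the quotient entries on the runners with charge 0. Uniqueness: an empty core
makes all charges 0, so the quotient determines every runner. -/
theorem existsUnique_isBar {p : ℕ} (hp : 0 < p) {lam : YoungDiagram} (h : lam.transpose = lam) :
    ∃! bar, IsBar p lam bar := by
  obtain ⟨bar, hbar⟩ := exists_maya_of_runners hp (quotient p lam)
  have hch : ∀ γ < p, (∀ j : ℤ, γ + j * p ∈ maya (core p bar) ↔ j < 0) ∧
      quotient p bar γ = quotient p lam γ := by
    intro γ hγ
    obtain ⟨c, h1, h2⟩ := exists_runner_charge bar hγ
    have h3 : ∀ j, j ∈ maya (quotient p bar γ) ↔ j + c ∈ maya (quotient p lam γ) := fun j => by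
      rw [h2, hbar γ hγ]
    obtain rfl := eq_zero_of_maya_shift h3
    exact ⟨h1, maya_injective (Set.ext fun j => by rw [h3, add_zero])⟩
  refine ⟨bar, ⟨?_, ?_, fun γ hγ => (hch γ hγ).2⟩, fun bar' hbar' => ?_⟩
  · rw [transpose_eq_self_iff_runner hp]
    intro γ hγ j
    obtain ⟨c, -, h2⟩ := exists_runner_charge lam hγ
    obtain ⟨c', -, h2'⟩ := exists_runner_charge lam (by omega : p - 1 - γ < p)
    rw [hbar γ hγ, hbar _ (by omega), (charge_dual h hγ h2 h2').2, not_not]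
    ring_nf
  · refine maya_ext_runner hp fun γ hγ j => ?_
    rw [(hch γ hγ).1, maya_bot, Set.mem_ofPred_eq, runner_neg_iff hγ]
  · refine maya_ext_runner hp fun γ hγ j => ?_
    rw [← mem_maya_quotient_of_core_eq_bot hbar'.core_eq hγ, hbar'.quotient_eq γ hγ, hbar γ hγ]

end DiagHooks

/-! ### The formula for the diagonal hook lengths -/

theorem theorem8p5 (p : ℕ) (hp : p.Prime) (lam : YoungDiagram) (hlam : lam.transpose = lam) :
    (∃! bar : YoungDiagram, DiagHooks.IsBar p lam bar) ∧
    ∀ bar : YoungDiagram, DiagHooks.IsBar p lam bar →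
      DiagHooks.diagHookLengths lam =
        ((DiagHooks.Omega1 p lam).biUnion fun γ =>
          (DiagHooks.quotientR p bar γ).image fun σ =>
            2 * (γ + (σ + DiagHooks.d0 p lam γ) * p) + 1) ∪
        ((DiagHooks.Omega1 p lam).biUnion fun γ =>
          (DiagHooks.setS p bar γ (DiagHooks.d0 p lam γ)).image fun s =>
            2 * (γ + (DiagHooks.d0 p lam γ - s - 1) * p) + 1) ∪
        ((DiagHooks.Omega1 p lam).biUnion fun γ =>
          (DiagHooks.setT p bar γ (DiagHooks.d0 p lam γ)).image fun t =>
            2 * ((p - 1 - γ) + (t - DiagHooks.d0 p lam γ) * p) + 1) ∪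
        ((DiagHooks.Omega2 p lam).biUnion fun γ =>
          (DiagHooks.quotientR p bar γ).image fun μ =>
            2 * (γ + μ * p) + 1) := by
  refine ⟨DiagHooks.existsUnique_isBar hp.pos hlam, fun bar hbar => ?_⟩
  have hdual : ∀ γ < p, p - 1 - γ < p ∧ p - 1 - (p - 1 - γ) = γ := fun γ hγ => by omega
  have hcharge : ∀ γ : ℕ, ∃ c : ℤ, γ < p →
      (∀ j : ℤ, γ + j * p ∈ DiagHooks.maya (DiagHooks.core p lam) ↔ j < c) ∧
      ∀ j : ℤ, j ∈ DiagHooks.maya (DiagHooks.quotient p lam γ) ↔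
        γ + (j + c) * p ∈ DiagHooks.maya lam := fun γ => by
    by_cases hγ : γ < p
    · obtain ⟨c, hc⟩ := DiagHooks.exists_runner_charge lam hγ
      exact ⟨c, fun _ => hc⟩
    · exact ⟨0, fun h => absurd h hγ⟩
  choose c hc using hcharge
  have hneg : ∀ γ < p, c (p - 1 - γ) = -c γ := fun γ hγ =>
    (DiagHooks.charge_dual hlam hγ (hc γ hγ).2 (hc _ (hdual γ hγ).1).2).1
  have hd : ∀ γ < p, DiagHooks.d0 p lam γ = (c γ).toNat := fun γ hγ =>
    DiagHooks.card_residuePart (DiagHooks.core_transpose hp.pos hlam) hγ (hc γ hγ).1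
  have hO1 : ∀ γ, γ ∈ DiagHooks.Omega1 p lam ↔ γ < p ∧ 0 < c γ := fun γ => by
    rw [DiagHooks.Omega1, Finset.mem_filter, Finset.mem_range]
    refine and_congr_right fun hγ => ?_
    rw [hd γ hγ]
    omega
  have hO2 : ∀ γ, γ ∈ DiagHooks.Omega2 p lam ↔ γ < p ∧ c γ = 0 := fun γ => by
    rw [DiagHooks.Omega2, Finset.mem_sdiff, Finset.mem_range, Finset.mem_union, Finset.mem_image]
    refine and_congr_right fun hγ => ?_
    have hn := hneg γ hγ
    constructor
    · intro h
      push Not at h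
      have h1 := hO1 γ
      have h2 := hO1 (p - 1 - γ)
      have h3 := h.2 (p - 1 - γ)
      have h4 := hdual γ hγ
      by_contra h0
      rcases lt_or_gt_of_ne h0 with h5 | h5
      · exact h3 (h2.2 ⟨h4.1, by omega⟩) h4.2
      · exact h.1 (h1.2 ⟨hγ, h5⟩)
    · rintro h (h1 | ⟨γ', h1, rfl⟩)
      · have := ((hO1 γ).1 h1).2
        omega
      · have h2 := (hO1 γ').1 h1
        have := hneg γ' h2.1
        omega
  have hmem : ∀ γ < p, ∀ j : ℤ, γ + j * p ∈ DiagHooks.maya bar ↔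
      γ + (j + c γ) * p ∈ DiagHooks.maya lam := fun γ hγ j => by
    rw [← DiagHooks.mem_maya_quotient_of_core_eq_bot hbar.core_eq hγ, hbar.quotient_eq γ hγ,
      (hc γ hγ).2]
  have hR : ∀ γ < p, ∀ m : ℕ, m ∈ DiagHooks.quotientR p bar γ ↔
      (γ : ℤ) + (m + c γ) * p ∈ DiagHooks.maya lam := fun γ hγ m => by
    rw [DiagHooks.mem_quotientR hbar.symmetric hγ, hmem γ hγ]
  have hL : ∀ γ < p, ∀ m : ℕ, m ∈ DiagHooks.quotientL p bar γ ↔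
      ((p - 1 - γ : ℕ) : ℤ) + (m - c γ) * p ∈ DiagHooks.maya lam := fun γ hγ m => by
    rw [DiagHooks.mem_quotientL hbar.symmetric hγ, hmem _ (hdual γ hγ).1, hneg γ hγ, sub_eq_add_neg]
  have hsymm := (DiagHooks.transpose_eq_self_iff_runner hp.pos).1 hlam
  ext n
  simp only [DiagHooks.mem_diagHookLengths hlam, Finset.mem_union, Finset.mem_biUnion,
    Finset.mem_image, DiagHooks.setS, DiagHooks.setT, Finset.mem_filter, Finset.mem_range, hO1, hO2]
  constructor
  · rintro ⟨b, hb, rfl⟩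
    obtain ⟨γ, hγ, j, rfl⟩ : ∃ γ < p, ∃ j : ℕ, b = γ + j * p :=
      ⟨b % p, Nat.mod_lt _ hp.pos, b / p, by rw [mul_comm, Nat.mod_add_div]⟩
    push_cast at hb
    rcases lt_trichotomy (c γ) 0 with h0 | h0 | h0
    · obtain ⟨h1, h2⟩ := hdual γ hγ
      have hn := hneg γ hγ
      -- The dual residue has charge -c γ > 0, and t = j + d⁰ is the position in `bar` that moves to
      -- j.
      refine Or.inl (Or.inr ⟨p - 1 - γ, ⟨h1, by omega⟩, j + (-c γ).toNat, ⟨?_, ?_⟩, ?_⟩)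
      · rw [hL _ h1, h2, hn]
        convert hb using 3
        omega
      · rw [hd _ h1, hn]
        omega
      · rw [hd _ h1, hn, h2, Nat.add_sub_cancel]
    · refine Or.inr ⟨γ, ⟨hγ, h0⟩, j, ?_, rfl⟩
      rwa [hR γ hγ, h0, add_zero]
    · by_cases hj : c γ ≤ j
      · refine Or.inl (Or.inl (Or.inl ⟨γ, ⟨hγ, h0⟩, j - (c γ).toNat, ?_, ?_⟩))
        · rw [hR γ hγ]
          convert hb using 3
          omega
        · rw [hd γ hγ, Nat.sub_add_cancel (by omega)]
      · refine Or.inl (Or.inl (Or.inr ⟨γ, ⟨hγ, h0⟩, (c γ).toNat - 1 - j, ⟨?_, ?_⟩, ?_⟩))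
        · rw [hd γ hγ]
          omega
        · rw [hL γ hγ]
          convert (hsymm γ hγ j).1 hb using 4
          omega
        · rw [hd γ hγ, (by omega : (c γ).toNat - ((c γ).toNat - 1 - j) - 1 = j)]
  · rintro (((⟨γ, ⟨hγ, h0⟩, s, hs, rfl⟩ | ⟨γ, ⟨hγ, h0⟩, s, ⟨hs, hs'⟩, rfl⟩) |
      ⟨γ, ⟨hγ, h0⟩, s, ⟨hs, hs'⟩, rfl⟩) | ⟨γ, ⟨hγ, h0⟩, s, hs, rfl⟩)
    · refine ⟨_, ?_, rfl⟩
      rw [hR γ hγ] at hs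
      rw [hd γ hγ]
      push_cast
      convert hs using 4
      omega
    · refine ⟨_, ?_, rfl⟩
      rw [hd γ hγ] at hs ⊢
      rw [hL γ hγ] at hs'
      rw [Nat.cast_add, Nat.cast_mul, hsymm γ hγ]
      convert hs' using 4
      omega
    · refine ⟨_, ?_, rfl⟩
      rw [hd γ hγ] at hs' ⊢
      rw [hL γ hγ] at hs
      rw [Nat.cast_add, Nat.cast_mul]
      convert hs using 3
      omega
    · refine ⟨_, ?_, rfl⟩
      rw [hR γ hγ, h0, add_zero] at hs
      rwa [Nat.cast_add, Nat.cast_mul]
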